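/- Let $A$ be a finite dimensional algebra over a field, and let $\operatorname{mod} A$ be the category of finite dimensional (equivalently, finitely generated) left $A$-modules. All subcategories are full and closed under isomorphisms. Let $K^b(A)$ be the bounded homotopy category of complexes of projective objects of $\operatorname{mod} A$, with shift $[1]$ and its usual triangulated structure, and let $\mathbf{E}\subset K^b(A)$ be the two-term category of $A$, i.e. the full subcategory of objects isomorphic to complexes concentrated in degrees $-1$ and $0$. A pair $(\mathbf{U},\mathbf{V})$ of subcategories of $\mathbf{E}$ is a complete cotorsion pair in $\mathbf{E}$ if: (i) for every $X\in\mathbf{E}$: $\operatorname{Hom}(U,X[1])=0$ for all $U\in\mathbf{U}$ if and only if $X\in\mathbf{V}$; and $\operatorname{Hom}(X,V[1])=0$ for all $V\in\mathbf{V}$ if and only if $X\in\mathbf{U}$; (ii) for every $X\in\mathbf{E}$ there are triangles $V\to U\to X\to V[1]$ and $X\to V'\to U'\to X[1]$ with $U,U'\in\mathbf{U}$ and $V,V'\in\mathbf{V}$. For a subcategory $\mathbf{W}$ of $\mathbf{E}$, let $H^0(\mathbf{W})$ be the subcategory of $\operatorname{mod} A$ of modules isomorphic to $H^0(W)$ for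 some $W\in\mathbf{W}$. Let $(\mathbf{U},\mathbf{V})$ be a complete cotorsion pair in $\mathbf{E}$, and put $\mathcal{C}=H^0(\mathbf{U})$, $\mathcal{T}=H^0(\mathbf{V})$. Then $(\mathcal{C},\mathcal{T})$ is a left weak cotorsion pair in $\operatorname{mod} A$, that is: (1) $\operatorname{Ext}^1_A(X,Y)=0$ for all $X\in\mathcal{C}$ and $Y\in\mathcal{T}$; (2) for every $M\in\operatorname{mod} A$ there are exact sequences $$0\to Y_M\to X_M\xrightarrow{f_M} M\to 0\quad\text{and}\quad M\xrightarrow{g^M} Y^M\to X^M\to 0$$ with $X_M,X^M\in\mathcal{C}$ and $Y_M,Y^M\in\mathcal{T}$, such that $f_M$ is a right $\mathcal{C}$-approximation of $M$ (every morphism $X\to M$ with $X\in\mathcal{C}$ factors through $f_M$) and $g^M$ is a left $\mathcal{T}$-approximation of $M$ (every morphism $M\to Y$ with $Y\in\mathcal{T}$ factors through $g^M$). -/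

import Mathlib

/-!
A stalk complex `Q` of a projective object is seen by `H⁰` like a projective object: `H⁰` is
bijective on `Hom(Q, -)` and kills the positive shifts of `Q`. A two-term complex `X` is the cone
of a morphism `Q₁ ⟶ Q₀` of such objects, so `H⁰` is full out of `X`, and `𝔼(X, Y) = 0` if and only
if every morphism `H⁰(Q₁) ⟶ H⁰(Y)` extends along `H⁰(Q₁) ⟶ H⁰(Q₀)`. The latter condition depends
only on `H⁰(Y)`, passes to its quotients, and implies `Ext¹(H⁰(X), N) = 0` for each of these
quotients `N`. In particular `H⁰(V)` is closed under quotients.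

Applying `H⁰` to `V' ⟶ U' ⟶ X ⟶ V'[1]` gives an exact sequence ending in an epimorphism, whose
kernel is a quotient of `H⁰(V')` and hence lies in `H⁰(V)`; the vanishing of `Ext¹` makes it a right
approximation. Applying `H⁰` to `X ⟶ V' ⟶ U' ⟶ X[1]` gives the left approximation by fullness.
-/

open CategoryTheory CategoryTheory.Limits CategoryTheory.Pretriangulated

universe u v w

namespace TwoTermCotorsion

section Extriangulated

variable {T : Type u} [Category.{v} T] [Preadditive T] [HasZeroObject T] [HasShift T ℤ]
  [∀ n : ℤ, (shiftFunctor T n).Additive] [Pretriangulated T]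

/-- `𝔼(X, Y) = Hom(X, Y[1])` vanishes. -/
def EVanishes (X Y : T) : Prop := ∀ f : X ⟶ Y⟦(1 : ℤ)⟧, f = 0

/-- Full subcategories `U`, `V` of the full (extension-closed) subcategory `E` of the
triangulated category `T` form a cotorsion pair in the extriangulated category `E`.
Both are automatically closed under isomorphisms when `E` is. -/
structure IsCotorsionPair (E U V : ObjectProperty T) : Prop where
  left_le : U ≤ E
  right_le : V ≤ E
  right_iff : ∀ X, E X → ((∀ W, U W → EVanishes W X) ↔ V X)
  left_iff : ∀ X, E X → ((∀ W, V W → EVanishes X W) ↔ U X)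

/-- `Cone(V, U)`: the objects `X` of `E` in a triangle `V' ⟶ U' ⟶ X ⟶ V'[1]` of objects of `E`
with `V'` in `V` and `U'` in `U`. -/
def cone (E V U : ObjectProperty T) : ObjectProperty T := fun X =>
  E X ∧ ∃ (V' U' : T) (f : V' ⟶ U') (g : U' ⟶ X) (h : X ⟶ V'⟦(1 : ℤ)⟧),
    E V' ∧ E U' ∧ V V' ∧ U U' ∧ Triangle.mk f g h ∈ distTriang T

/-- `Cocone(V, U)`: the objects `X` of `E` in a triangle `X ⟶ V' ⟶ U' ⟶ X[1]` of objects of `E`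
with `V'` in `V` and `U'` in `U`. -/
def cocone (E V U : ObjectProperty T) : ObjectProperty T := fun X =>
  E X ∧ ∃ (V' U' : T) (f : X ⟶ V') (g : V' ⟶ U') (h : U' ⟶ X⟦(1 : ℤ)⟧),
    E V' ∧ E U' ∧ V V' ∧ U U' ∧ Triangle.mk f g h ∈ distTriang T

/-- A complete cotorsion pair `(U, V)` in `E`: moreover `E = Cone(V, U) = Cocone(V, U)`. -/
structure IsCompleteCotorsionPair (E U V : ObjectProperty T) : Prop
    extends IsCotorsionPair E U V where
  cone_eq : cone E V U = E
  cocone_eq : cocone E V U = E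

end Extriangulated

section Approximation

variable {C : Type u} [Category.{v} C]

/-- `f : X ⟶ M` is a right `P`-approximation of `M`. -/
def IsRightApproximation (P : ObjectProperty C) {X M : C} (f : X ⟶ M) : Prop :=
  P X ∧ ∀ (X' : C), P X' → ∀ h : X' ⟶ M, ∃ l : X' ⟶ X, l ≫ f = h

/-- `g : M ⟶ Y` is a left `P`-approximation of `M`. -/
def IsLeftApproximation (P : ObjectProperty C) {M Y : C} (g : M ⟶ Y) : Prop :=
  P Y ∧ ∀ (Y' : C), P Y' → ∀ h : M ⟶ Y', ∃ l : Y ⟶ Y', g ≫ l = h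

end Approximation

section Modules

variable (A : Type u) [Ring A]

/-- The homotopy category of cochain complexes of left `A`-modules. -/
abbrev K : Type (u + 1) := HomotopyCategory (ModuleCat.{u} A) (ComplexShape.up ℤ)

/-- The two-term category of `A`: the full subcategory of the homotopy category whose objects are
(up to isomorphism) the complexes of finitely generated projective modules concentrated
in degrees `-1` and `0`. -/
def twoTerm : ObjectProperty (K A) := fun X =>
  ∃ P : CochainComplex (ModuleCat.{u} A) ℤ,
    (∀ i, ModuleCat.isFG A (P.X i) ∧ Projective (P.X i)) ∧
    (∀ i, i ≠ -1 → i ≠ 0 → IsZero (P.X i)) ∧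
    Nonempty (X ≅ (HomotopyCategory.quotient (ModuleCat.{u} A) (ComplexShape.up ℤ)).obj P)

variable {A}

/-- `H⁰(U)`: the full subcategory of modules isomorphic to `H⁰(X)` for some `X` in `U`. -/
noncomputable def H0 (U : ObjectProperty (K A)) : ObjectProperty (ModuleCat.{u} A) :=
  U.map (HomotopyCategory.homologyFunctor (ModuleCat.{u} A) (ComplexShape.up ℤ) 0)

/-- A left weak cotorsion pair `(C, T)` in `mod A`, the full subcategory of finitely generated
left `A`-modules. -/
structure IsLeftWeakCotorsionPair (C T : ObjectProperty (ModuleCat.{u} A)) : Prop where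
  left_le : C ≤ ModuleCat.isFG A
  right_le : T ≤ ModuleCat.isFG A
  left_iso : C.IsClosedUnderIsomorphisms
  right_iso : T.IsClosedUnderIsomorphisms
  ext_eq_zero : ∀ X Y, C X → T Y → ∀ e : Abelian.Ext X Y 1, e = 0
  /-- `0 ⟶ Y ⟶ X ⟶ M ⟶ 0` -/
  exists_right : ∀ M, ModuleCat.isFG A M →
    ∃ (Y X : ModuleCat.{u} A) (i : Y ⟶ X) (f : X ⟶ M) (zero : i ≫ f = 0),
      C X ∧ T Y ∧ (ShortComplex.mk i f zero).ShortExact ∧ IsRightApproximation C f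
  /-- `M ⟶ Y ⟶ X ⟶ 0` -/
  exists_left : ∀ M, ModuleCat.isFG A M →
    ∃ (Y X : ModuleCat.{u} A) (g : M ⟶ Y) (p : Y ⟶ X) (zero : g ≫ p = 0),
      C X ∧ T Y ∧ (ShortComplex.mk g p zero).Exact ∧ Epi p ∧ IsLeftApproximation T g

end Modules

end TwoTermCotorsion

namespace TwoTermCotorsion

section Abelian

variable {C : Type u} [Category.{v} C] [Abelian C]

lemma exact_comp_iso {S : ShortComplex C} (hS : S.Exact) {M : C} (e : S.X₃ ≅ M) :
    (ShortComplex.mk S.f (S.g ≫ e.hom) (by simp)).Exact :=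
  (ShortComplex.exact_iff_of_iso (S₁ := S) (S₂ := .mk S.f (S.g ≫ e.hom) (by simp))
    (ShortComplex.isoMk (Iso.refl _) (Iso.refl _) e)).1 hS

lemma exact_iso_comp {S : ShortComplex C} (hS : S.Exact) {M : C} (e : M ≅ S.X₁) :
    (ShortComplex.mk (e.hom ≫ S.f) S.g (by simp)).Exact :=
  (ShortComplex.exact_iff_of_iso (S₂ := S) (S₁ := .mk (e.hom ≫ S.f) S.g (by simp))
    (ShortComplex.isoMk e (Iso.refl _) (Iso.refl _))).2 hS

variable [HasExt.{w} C]

lemma exists_lift_of_ext_eq_zero {S : ShortComplex C} (hS : S.ShortExact) {X : C}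
    (h : ∀ e : Abelian.Ext X S.X₁ 1, e = 0) (a : X ⟶ S.X₃) : ∃ b : X ⟶ S.X₂, b ≫ S.g = a := by
  obtain ⟨x, hx⟩ :=
    Abelian.Ext.covariant_sequence_exact₃ X hS (Abelian.Ext.mk₀ a) (zero_add 1) (h _)
  obtain ⟨b, rfl⟩ := Abelian.Ext.addEquiv₀.symm.surjective x
  exact ⟨b, Abelian.Ext.addEquiv₀.symm.injective (by simpa using hx)⟩

lemma ext_eq_zero_of_shortExact {S : ShortComplex C} (hS : S.ShortExact) [Projective S.X₂]
    {N : C} (H : ∀ a : S.X₁ ⟶ N, ∃ b : S.X₂ ⟶ N, S.f ≫ b = a) (e : Abelian.Ext S.X₃ N 1) :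
    e = 0 := by
  obtain ⟨x, rfl⟩ := Abelian.Ext.contravariant_sequence_exact₃ hS N e
    (Abelian.Ext.eq_zero_of_projective _) (n₀ := 0) (by simp)
  obtain ⟨a, rfl⟩ := Abelian.Ext.addEquiv₀.symm.surjective x
  obtain ⟨b, rfl⟩ := H a
  simp [← Abelian.Ext.mk₀_comp_mk₀]

lemma ext_eq_zero_of_exact {S : ShortComplex C} (hS : S.Exact) [Epi S.g] [Projective S.X₂]
    {N : C} (H : ∀ a : S.X₁ ⟶ N, ∃ b : S.X₂ ⟶ N, S.f ≫ b = a) (e : Abelian.Ext S.X₃ N 1) :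
    e = 0 := by
  have : Epi (kernel.lift S.g S.f S.zero) := hS.epi_kernelLift
  have hK : (ShortComplex.mk _ _ (kernel.condition S.g)).ShortExact :=
    { exact := ShortComplex.exact_of_f_is_kernel _ (kernelIsKernel S.g) }
  refine ext_eq_zero_of_shortExact hK (fun a => ?_) e
  obtain ⟨b, hb⟩ := H (kernel.lift S.g S.f S.zero ≫ a)
  exact ⟨b, by simp [← cancel_epi (kernel.lift S.g S.f S.zero), hb]⟩

end Abelian

section Homological

universe u' v'

variable {T : Type u} [Category.{v} T] [HasShift T ℤ] {C : Type u'} [Category.{v'} C]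

variable (F : T ⥤ C) in
/-- `Q` behaves, with respect to the homological functor `F`, like the stalk complex of a
projective object with respect to `H⁰`. -/
structure IsProjectiveFor (Q : T) : Prop where
  projective : Projective (F.obj Q)
  bijective_map (Y : T) : Function.Bijective (F.map : (Q ⟶ Y) → (F.obj Q ⟶ F.obj Y))
  isZero_map_shift (n : ℤ) (hn : 0 < n) : IsZero (F.obj (Q⟦n⟧))

variable {F : T ⥤ C}

lemma IsProjectiveFor.of_iso {Q Q' : T} (h : IsProjectiveFor F Q) (e : Q ≅ Q') :
    IsProjectiveFor F Q' where
  projective := Projective.of_iso (F.mapIso e) h.projective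
  bijective_map Y := by
    constructor
    · intro f g hfg
      rw [← cancel_epi e.hom]
      exact (h.bijective_map Y).1 (by simp [hfg])
    · intro φ
      obtain ⟨f, hf⟩ := (h.bijective_map Y).2 (F.map e.hom ≫ φ)
      exact ⟨e.inv ≫ f, by simp [hf]⟩
  isZero_map_shift n hn :=
    (h.isZero_map_shift n hn).of_iso (F.mapIso ((shiftFunctor T n).mapIso e).symm)

lemma IsCotorsionPair.eVanishes [Preadditive T] {E U V : ObjectProperty T}
    (h : IsCotorsionPair E U V) {X Y : T} (hX : U X) (hY : V Y) : EVanishes X Y :=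
  (h.right_iff Y (h.right_le _ hY)).2 hY X hX

variable [Preadditive T] [HasZeroObject T] [∀ n : ℤ, (shiftFunctor T n).Additive]
  [Pretriangulated T]

lemma EVanishes.exists_extension {Y : T} {S : Triangle T} (h : EVanishes S.obj₃ Y)
    (hS : S ∈ distTriang T) (a : S.obj₁ ⟶ Y) : ∃ b : S.obj₂ ⟶ Y, S.mor₁ ≫ b = a := by
  obtain ⟨b, hb⟩ : ∃ b : S.obj₂⟦(1 : ℤ)⟧ ⟶ Y⟦(1 : ℤ)⟧, a⟦(1 : ℤ)⟧' = (-S.mor₁⟦(1 : ℤ)⟧') ≫ b :=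
    Triangle.yoneda_exact₃ _ (rot_of_distTriang _ hS) _ (h (S.mor₃ ≫ a⟦(1 : ℤ)⟧'))
  obtain ⟨c, rfl⟩ := (shiftFunctor T (1 : ℤ)).map_surjective b
  exact ⟨-c, (shiftFunctor T (1 : ℤ)).map_injective (by simp [hb])⟩

variable (F) in
/-- A presentation of `X` as the cone of a morphism between objects that are projective for `F`:
for `F = H⁰`, the expression of a two-term complex as the cone of its differential. -/
structure TwoTermPresentation (X : T) where
  Q₁ : T
  Q₀ : T
  d : Q₁ ⟶ Q₀
  p : Q₀ ⟶ X
  δ : X ⟶ Q₁⟦(1 : ℤ)⟧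
  distinguished : Triangle.mk d p δ ∈ distTriang T
  isProjectiveFor₁ : IsProjectiveFor F Q₁
  isProjectiveFor₀ : IsProjectiveFor F Q₀

/-- Transport of a presentation along an isomorphism. -/
def TwoTermPresentation.ofIso {X X' : T} (P : TwoTermPresentation F X) (e : X ≅ X') :
    TwoTermPresentation F X' where
  Q₁ := P.Q₁
  Q₀ := P.Q₀
  d := P.d
  p := P.p ≫ e.hom
  δ := e.inv ≫ P.δ
  distinguished := isomorphic_distinguished _ P.distinguished _
    (Triangle.isoMk _ _ (Iso.refl P.Q₁) (Iso.refl P.Q₀) e.symm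
      (by change P.d ≫ 𝟙 P.Q₀ = 𝟙 P.Q₁ ≫ P.d; simp)
      (by change (P.p ≫ e.hom) ≫ e.inv = 𝟙 P.Q₀ ≫ P.p; simp)
      (by change (e.inv ≫ P.δ) ≫ (𝟙 P.Q₁)⟦(1 : ℤ)⟧' = e.inv ≫ P.δ; simp))
  isProjectiveFor₁ := P.isProjectiveFor₁
  isProjectiveFor₀ := P.isProjectiveFor₀

lemma TwoTermPresentation.d_comp_p {X : T} (P : TwoTermPresentation F X) : P.d ≫ P.p = 0 :=
  comp_distTriang_mor_zero₁₂ _ P.distinguished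

lemma EVanishes.exists_extension_map {X Y : T} (h : EVanishes X Y) (P : TwoTermPresentation F X)
    {N : C} (q : F.obj Y ⟶ N) [Epi q] (φ : F.obj P.Q₁ ⟶ N) :
    ∃ g : F.obj P.Q₀ ⟶ N, F.map P.d ≫ g = φ := by
  have := P.isProjectiveFor₁.projective
  obtain ⟨a, ha⟩ := (P.isProjectiveFor₁.bijective_map Y).2 (Projective.factorThru φ q)
  obtain ⟨b, rfl⟩ : ∃ b : P.Q₀ ⟶ Y, P.d ≫ b = a := h.exists_extension P.distinguished a
  exact ⟨F.map b ≫ q, by simpa using ha =≫ q⟩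

lemma eVanishes_of_forall_exists_extension {X Y : T} (P : TwoTermPresentation F X)
    (hY : IsZero (F.obj (Y⟦(1 : ℤ)⟧)))
    (H : ∀ φ : F.obj P.Q₁ ⟶ F.obj Y, ∃ g : F.obj P.Q₀ ⟶ F.obj Y, F.map P.d ≫ g = φ) :
    EVanishes X Y := fun f => by
  have hpf : P.p ≫ f = 0 := (P.isProjectiveFor₀.bijective_map _).1 (hY.eq_of_tgt _ _)
  obtain ⟨b, rfl⟩ : ∃ b : P.Q₁⟦(1 : ℤ)⟧ ⟶ Y⟦(1 : ℤ)⟧, f = P.δ ≫ b :=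
    Triangle.yoneda_exact₃ _ P.distinguished f hpf
  obtain ⟨a, rfl⟩ := (shiftFunctor T (1 : ℤ)).map_surjective b
  obtain ⟨g, hg⟩ := H (F.map a)
  obtain ⟨c, rfl⟩ := (P.isProjectiveFor₀.bijective_map Y).2 g
  obtain rfl : P.d ≫ c = a := (P.isProjectiveFor₁.bijective_map Y).1 (by simpa using hg)
  have hδd : P.δ ≫ P.d⟦(1 : ℤ)⟧' = 0 := comp_distTriang_mor_zero₃₁ _ P.distinguished
  rw [Functor.map_comp, reassoc_of% hδd, zero_comp]

lemma EVanishes.of_epi {X Y Z : T} (h : EVanishes X Y) (P : TwoTermPresentation F X)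
    (hZ : IsZero (F.obj (Z⟦(1 : ℤ)⟧))) (q : F.obj Y ⟶ F.obj Z) [Epi q] : EVanishes X Z :=
  eVanishes_of_forall_exists_extension P hZ (h.exists_extension_map P q)

variable [Abelian C] [F.IsHomological]

lemma epi_map_mor₂ {S : Triangle T} (hS : S ∈ distTriang T)
    (h : IsZero (F.obj (S.obj₁⟦(1 : ℤ)⟧))) : Epi (F.map S.mor₂) :=
  (F.map_distinguished_exact _ (rot_of_distTriang _ hS)).epi_f (h.eq_of_tgt _ _)

namespace TwoTermPresentation

variable {X : T} (P : TwoTermPresentation F X)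

include P in
lemma isZero_map_shift : IsZero (F.obj (X⟦(1 : ℤ)⟧)) := by
  have h := F.map_distinguished_exact _
    (rot_of_distTriang _ (Triangle.shift_distinguished _ P.distinguished 1))
  have h₁ : IsZero (F.obj (P.Q₁⟦(1 : ℤ)⟧⟦(1 : ℤ)⟧)) :=
    (P.isProjectiveFor₁.isZero_map_shift 2 (by simp)).of_iso
      (F.mapIso ((shiftFunctorAdd' T 1 1 2 (by simp)).app P.Q₁).symm)
  exact h.isZero_of_both_zeros
    ((P.isProjectiveFor₀.isZero_map_shift 1 (by simp)).eq_of_src _ _) (h₁.eq_of_tgt _ _)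

lemma epi_map_p : Epi (F.map P.p) :=
  epi_map_mor₂ P.distinguished (P.isProjectiveFor₁.isZero_map_shift 1 (by simp))

include P in
lemma map_surjective (Y : T) :
    Function.Surjective (F.map : (X ⟶ Y) → (F.obj X ⟶ F.obj Y)) := fun φ => by
  obtain ⟨g, hg⟩ := (P.isProjectiveFor₀.bijective_map Y).2 (F.map P.p ≫ φ)
  have hdg : P.d ≫ g = 0 := (P.isProjectiveFor₁.bijective_map Y).1 (by
    rw [F.map_comp, hg, ← F.map_comp_assoc, P.d_comp_p, F.map_zero, F.map_zero, zero_comp])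
  obtain ⟨f, rfl⟩ : ∃ f : X ⟶ Y, g = P.p ≫ f := Triangle.yoneda_exact₂ _ P.distinguished g hdg
  have := P.epi_map_p
  exact ⟨f, by simpa only [F.map_comp, cancel_epi] using hg⟩

end TwoTermPresentation

lemma EVanishes.ext_eq_zero [HasExt.{w} C] {X Y : T} (h : EVanishes X Y)
    (P : TwoTermPresentation F X) {M N : C} (i : F.obj X ≅ M) (q : F.obj Y ⟶ N) [Epi q]
    (e : Abelian.Ext M N 1) : e = 0 := by
  have := P.epi_map_p
  have := P.isProjectiveFor₀.projective
  let S : ShortComplex C := ShortComplex.mk (F.map P.d) (F.map P.p ≫ i.hom) (by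
    rw [← F.map_comp_assoc, P.d_comp_p, F.map_zero, zero_comp])
  have hS : S.Exact := exact_comp_iso (F.map_distinguished_exact _ P.distinguished) i
  have : Projective S.X₂ := P.isProjectiveFor₀.projective
  have : Epi S.g := epi_comp _ _
  exact ext_eq_zero_of_exact hS (h.exists_extension_map P q) e

variable {E U V : ObjectProperty T}

namespace IsCotorsionPair

variable (h : IsCotorsionPair E U V) (hE : ∀ X, E X → Nonempty (TwoTermPresentation F X))

include h hE

lemma ext_map_eq_zero [HasExt.{w} C] {M N : C} (hM : U.map F M) (hN : V.map F N)
    (e : Abelian.Ext M N 1) : e = 0 := by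
  obtain ⟨X, hX, ⟨i⟩⟩ := hM
  obtain ⟨Y, hY, ⟨j⟩⟩ := hN
  obtain ⟨P⟩ := hE X (h.left_le _ hX)
  exact (h.eVanishes hX hY).ext_eq_zero P i j.hom e

lemma isClosedUnderQuotients_map_right [(E.map F).IsClosedUnderQuotients] :
    (V.map F).IsClosedUnderQuotients where
  prop_of_epi {M N} q _ hM := by
    obtain ⟨Z, hZ, ⟨k⟩⟩ :=
      (E.map F).prop_of_epi q (ObjectProperty.map_monotone h.right_le F M hM)
    obtain ⟨Y, hY, ⟨j⟩⟩ := hM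
    obtain ⟨R⟩ := hE Z hZ
    refine ⟨Z, (h.right_iff Z hZ).1 fun X hX => ?_, ⟨k⟩⟩
    obtain ⟨P⟩ := hE X (h.left_le _ hX)
    exact (h.eVanishes hX hY).of_epi P R.isZero_map_shift (j.hom ≫ q ≫ k.inv)

lemma isRightApproximation_of_shortExact {S : ShortComplex C}
    (hS : S.ShortExact) (h₁ : V.map F S.X₁) (h₂ : U.map F S.X₂) :
    IsRightApproximation (U.map F) S.g :=
  have : HasExt.{max u' v'} C := HasExt.standard C
  ⟨h₂, fun _ hX => exists_lift_of_ext_eq_zero hS (h.ext_map_eq_zero hE hX h₁)⟩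

lemma isLeftApproximation_map {S : Triangle T} (hS : S ∈ distTriang T) (h₁ : E S.obj₁)
    (h₂ : V S.obj₂) (h₃ : U S.obj₃) : IsLeftApproximation (V.map F) (F.map S.mor₁) := by
  refine ⟨V.prop_map_obj F h₂, ?_⟩
  rintro N ⟨Y, hY, ⟨j⟩⟩ a
  obtain ⟨P⟩ := hE _ h₁
  obtain ⟨b, hb⟩ := P.map_surjective Y (a ≫ j.inv)
  obtain ⟨c, rfl⟩ := (h.eVanishes h₃ hY).exists_extension hS b
  exact ⟨F.map c ≫ j.hom, by
    rw [← F.map_comp_assoc, hb, Category.assoc, j.inv_hom_id, Category.comp_id]⟩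

end IsCotorsionPair

lemma IsLeftApproximation.iso_comp {C : Type*} [Category C] {P : ObjectProperty C} {M M' Y : C}
    {g : M ⟶ Y} (hg : IsLeftApproximation P g) (e : M' ≅ M) :
    IsLeftApproximation P (e.hom ≫ g) := by
  refine ⟨hg.1, fun Y' hY' a => ?_⟩
  obtain ⟨l, hl⟩ := hg.2 Y' hY' (e.inv ≫ a)
  exact ⟨l, by simp [hl]⟩

namespace IsCompleteCotorsionPair

variable (h : IsCompleteCotorsionPair E U V)
  (hE : ∀ X, E X → Nonempty (TwoTermPresentation F X))

include h hE

lemma exists_rightApproximation_map [(E.map F).IsClosedUnderQuotients] {M : C}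
    (hM : E.map F M) :
    ∃ (Y X : C) (i : Y ⟶ X) (f : X ⟶ M) (zero : i ≫ f = 0),
      U.map F X ∧ V.map F Y ∧ (ShortComplex.mk i f zero).ShortExact ∧
        IsRightApproximation (U.map F) f := by
  obtain ⟨X, hX, ⟨e⟩⟩ := hM
  rw [← h.cone_eq] at hX
  obtain ⟨-, V', U', f, g, δ, hV'E, -, hV', hU', hT⟩ := hX
  obtain ⟨P⟩ := hE _ hV'E
  have : Epi (F.map g) := epi_map_mor₂ hT P.isZero_map_shift
  let q : F.obj U' ⟶ M := F.map g ≫ e.hom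
  have hfq := exact_comp_iso (F.map_distinguished_exact _ hT) e
  have : Epi (kernel.lift q (F.map f) _) := hfq.epi_kernelLift
  have hKS : (ShortComplex.mk _ _ (kernel.condition q)).ShortExact :=
    { exact := ShortComplex.exact_of_f_is_kernel _ (kernelIsKernel q) }
  have := h.isClosedUnderQuotients_map_right hE
  have hK : V.map F (kernel q) :=
    (V.map F).prop_of_epi (kernel.lift q (F.map f) _) (V.prop_map_obj F hV')
  have hU : U.map F (F.obj U') := U.prop_map_obj F hU'
  exact ⟨_, _, _, q, _, hU, hK, hKS, h.isRightApproximation_of_shortExact hE hKS hK hU⟩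

lemma exists_leftApproximation_map {M : C} (hM : E.map F M) :
    ∃ (Y X : C) (g : M ⟶ Y) (p : Y ⟶ X) (zero : g ≫ p = 0),
      U.map F X ∧ V.map F Y ∧ (ShortComplex.mk g p zero).Exact ∧ Epi p ∧
        IsLeftApproximation (V.map F) g := by
  obtain ⟨X, hX, ⟨e⟩⟩ := hM
  obtain ⟨P⟩ := hE X hX
  have hX' := hX
  rw [← h.cocone_eq] at hX'
  obtain ⟨-, V', U', f, g, δ, -, -, hV', hU', hT⟩ := hX'
  exact ⟨_, _, e.inv ≫ F.map f, F.map g, _, U.prop_map_obj F hU', V.prop_map_obj F hV',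
    exact_iso_comp (F.map_distinguished_exact _ hT) e.symm, epi_map_mor₂ hT P.isZero_map_shift,
    (h.isLeftApproximation_map hE hT hX hV' hU').iso_comp e.symm⟩

end IsCompleteCotorsionPair

end Homological

lemma bijective_map_of_iso_comp {B T C : Type*} [Category B] [Category T] [Category C]
    [Preadditive T] [Preadditive C] {L : B ⥤ T} {H : T ⥤ C} {G : B ⥤ C} [L.Full] [H.Additive]
    (e : L ⋙ H ≅ G) {X Y : B} (hsurj : ∀ ψ : G.obj X ⟶ G.obj Y, ∃ f, G.map f = ψ)
    (hzero : ∀ {f : X ⟶ Y}, G.map f = 0 → L.map f = 0) :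
    Function.Bijective (H.map : (L.obj X ⟶ L.obj Y) → _) := by
  constructor
  · refine (injective_iff_map_eq_zero H.mapAddHom).2 fun f hf => ?_
    obtain ⟨f, rfl⟩ := L.map_surjective f
    replace hf : H.map (L.map f) = 0 := hf
    exact hzero (by rw [← NatIso.naturality_1 e f, Functor.comp_map, hf, zero_comp, comp_zero])
  · intro φ
    obtain ⟨f, hf⟩ := hsurj (e.inv.app X ≫ φ ≫ e.hom.app Y)
    exact ⟨L.map f, (NatIso.naturality_2 e f).symm.trans (by simp [hf])⟩

section Complexes

open HomologicalComplex CochainComplex.HomComplex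

variable {C : Type u} [Category.{v} C] [Abelian C] {Q : C} {K : CochainComplex C ℤ}

lemma singleObjHomologySelfIso_inv_homologyMap_homologyι (f : (single C (.up ℤ) 0).obj Q ⟶ K) :
    (singleObjHomologySelfIso (.up ℤ) 0 Q).inv ≫ homologyMap f 0 ≫ K.homologyι 0 =
      (singleObjXSelf (.up ℤ) 0 Q).inv ≫ f.f 0 ≫ K.pOpcycles 0 := by
  rw [homologyι_naturality, singleObjHomologySelfIso_inv_homologyι_assoc,
    singleObjOpcyclesSelfIso_hom, Category.assoc, p_opcyclesMap]

lemma exact_d_pOpcycles (K : CochainComplex C ℤ) :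
    (ShortComplex.mk _ _ (K.d_pOpcycles (-1) 0)).Exact :=
  ShortComplex.exact_of_g_is_cokernel _ (K.opcyclesIsCokernel (-1) 0 (by simp))

lemma exists_exact_homologyFunctor_quotient (hK : K.d 0 1 = 0) :
    ∃ (p : K.X 0 ⟶ (HomotopyCategory.homologyFunctor C (.up ℤ) 0).obj
        ((HomotopyCategory.quotient C (.up ℤ)).obj K)) (w : K.d (-1) 0 ≫ p = 0),
      Epi p ∧ (ShortComplex.mk _ _ w).Exact := by
  have := K.isIso_homologyι 0 1 (by simp) hK
  let e : K.opcycles 0 ≅ (HomotopyCategory.homologyFunctor C (.up ℤ) 0).obj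
      ((HomotopyCategory.quotient C (.up ℤ)).obj K) :=
    (asIso (K.homologyι 0)).symm ≪≫
      ((HomotopyCategory.homologyFunctorFactors C (.up ℤ) 0).app K).symm
  exact ⟨K.pOpcycles 0 ≫ e.hom, _, inferInstance, exact_comp_iso (exact_d_pOpcycles K) e⟩

lemma isZero_homologyFunctor_quotient_shift {n : ℤ} (hK : IsZero (K.X n)) :
    IsZero ((HomotopyCategory.homologyFunctor C (.up ℤ) 0).obj
      (((HomotopyCategory.quotient C (.up ℤ)).obj K)⟦n⟧)) := by
  have hK' : IsZero ((K⟦n⟧).X 0) := by simpa using hK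
  exact (ShortComplex.isZero_homology_of_isZero_X₂ _ hK').of_iso
    ((HomotopyCategory.homologyFunctor C (.up ℤ) 0).mapIso
      (((HomotopyCategory.quotient C (.up ℤ)).commShiftIso n).app K).symm ≪≫
        (HomotopyCategory.homologyFunctorFactors C (.up ℤ) 0).app (K⟦n⟧))

/-- The complex `P₁ ⟶ P₀` with `P₁` in degree `-1` and `P₀` in degree `0`. -/
noncomputable abbrev twoTermComplex {P₁ P₀ : C} (d : P₁ ⟶ P₀) : CochainComplex C ℤ :=
  double d (c := .up ℤ) (i₀ := -1) (i₁ := 0) (by simp)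

lemma nonempty_homologyFunctor_twoTermComplex_iso {S : ShortComplex C} (hS : S.Exact) [Epi S.g] :
    Nonempty ((HomotopyCategory.homologyFunctor C (.up ℤ) 0).obj
      ((HomotopyCategory.quotient C (.up ℤ)).obj (twoTermComplex S.f)) ≅ S.X₃) := by
  have h : (ComplexShape.up ℤ).Rel (-1) 0 := by simp
  obtain ⟨p, w, _, hp⟩ :=
    exists_exact_homologyFunctor_quotient (double_d_eq_zero₀ S.f h 0 1 (by simp))
  let e : Arrow.mk ((twoTermComplex S.f).d (-1) 0) ≅ Arrow.mk S.f :=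
    Arrow.isoMk (doubleXIso₀ S.f h) (doubleXIso₁ S.f h (by simp))
      (by simp [double_d S.f h (by simp)])
  exact ⟨CokernelCofork.mapIsoOfIsColimit hp.gIsCokernel hS.gIsCokernel e⟩

section Projective

variable [Projective Q]

lemma exists_homologyMap_single_eq (ψ : ((single C (.up ℤ) 0).obj Q).homology 0 ⟶ K.homology 0) :
    ∃ f : (single C (.up ℤ) 0).obj Q ⟶ K, homologyMap f 0 = ψ := by
  let e := singleObjHomologySelfIso (.up ℤ) 0 Q
  let c : Q ⟶ K.cycles 0 := Projective.factorThru (e.inv ≫ ψ) (K.homologyπ 0)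
  have hc : c ≫ K.homologyπ 0 = e.inv ≫ ψ := Projective.factorThru_comp _ _
  refine ⟨mkHomFromSingle (c ≫ K.iCycles 0) (by simp), ?_⟩
  rw [← cancel_epi e.inv, ← cancel_mono (K.homologyι 0), ← hc, Category.assoc,
    singleObjHomologySelfIso_inv_homologyMap_homologyι, mkHomFromSingle_f]
  simp

lemma quotient_map_eq_zero_of_homologyMap_single_eq_zero {f : (single C (.up ℤ) 0).obj Q ⟶ K}
    (hf : homologyMap f 0 = 0) : (HomotopyCategory.quotient C (.up ℤ)).map f = 0 := by
  obtain ⟨φ, hφ⟩ := Cochain.fromSingleMk_surjective (p := 0) (Cochain.ofHom f) 0 (zero_add 0)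
  have hφf : φ = (singleObjXSelf (.up ℤ) 0 Q).inv ≫ f.f 0 :=
    (Iso.eq_inv_comp _).2 <| (Cochain.fromSingleMk_v φ (zero_add 0)).symm.trans <|
      (Cochain.congr_v hφ 0 0 (zero_add 0)).trans (Cochain.ofHom_v f 0)
  have hφ₀ : φ ≫ K.pOpcycles 0 = 0 := by
    rw [hφf, Category.assoc, ← singleObjHomologySelfIso_inv_homologyMap_homologyι, hf, zero_comp,
      comp_zero]
  let g : Q ⟶ K.X (-1) := (exact_d_pOpcycles K).liftFromProjective φ hφ₀
  have hg : g ≫ K.d (-1) 0 = φ := (exact_d_pOpcycles K).liftFromProjective_comp φ hφ₀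
  rw [HomotopyCategory.quotient_map_eq_zero_iff]
  refine ⟨(Cochain.equivHomotopy f 0).symm
    ⟨Cochain.fromSingleMk g (zero_add (-1)), hφ.symm.trans ?_⟩⟩
  rw [Cochain.ofHom_zero, add_zero, ← hg]
  exact (Cochain.δ_fromSingleMk g (zero_add (-1)) 0 0 (zero_add 0)).symm

variable (Q)

lemma isProjectiveFor_single :
    IsProjectiveFor (HomotopyCategory.homologyFunctor C (.up ℤ) 0)
      ((HomotopyCategory.singleFunctor C 0).obj Q) where
  projective :=
    let e : (HomotopyCategory.homologyFunctor C (.up ℤ) 0).obj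
        ((HomotopyCategory.singleFunctor C 0).obj Q) ≅ Q :=
      (HomotopyCategory.homologyFunctorFactors C (.up ℤ) 0).app _ ≪≫
        singleObjHomologySelfIso (.up ℤ) 0 Q
    Projective.of_iso e.symm inferInstance
  bijective_map Y := by
    obtain ⟨K, rfl⟩ := HomotopyCategory.quotient_obj_surjective Y
    exact bijective_map_of_iso_comp (HomotopyCategory.homologyFunctorFactors C (.up ℤ) 0)
      exists_homologyMap_single_eq quotient_map_eq_zero_of_homologyMap_single_eq_zero
  isZero_map_shift n hn :=
    isZero_homologyFunctor_quotient_shift (isZero_single_obj_X _ _ _ _ hn.ne')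

lemma isProjectiveFor_single_shift (n : ℤ) :
    IsProjectiveFor (HomotopyCategory.homologyFunctor C (.up ℤ) 0)
      (((HomotopyCategory.singleFunctor C n).obj Q)⟦n⟧) :=
  (isProjectiveFor_single Q).of_iso
    (((HomotopyCategory.singleFunctors C).shiftIso n 0 n (add_zero n)).app Q).symm

end Projective

/-- The short exact sequence `P⁰ ⟶ P ⟶ P⁻¹[1]` of complexes, where the terms `P⁰` and `P⁻¹` of
the two-term complex `P` are seen as stalk complexes. It splits in each degree, so it yields
the triangle expressing `P` as the cone of its differential. -/
noncomputable def stalkShortComplex (P : CochainComplex C ℤ)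
    (hP : ∀ i, i ≠ -1 → i ≠ 0 → IsZero (P.X i)) : ShortComplex (CochainComplex C ℤ) where
  X₁ := (single C (.up ℤ) 0).obj (P.X 0)
  X₂ := P
  X₃ := (single C (.up ℤ) (-1)).obj (P.X (-1))
  f := mkHomFromSingle (𝟙 (P.X 0)) fun k hk =>
    (hP k (by simp at hk; omega) (by simp at hk; omega)).eq_of_tgt _ _
  g := mkHomToSingle (𝟙 (P.X (-1))) fun k hk =>
    (hP k (by simp at hk; omega) (by simp at hk; omega)).eq_of_src _ _
  zero := from_single_hom_ext ((isZero_single_obj_X _ _ _ _ (by simp)).eq_of_tgt _ _)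

variable {P : CochainComplex C ℤ} (hP : ∀ i, i ≠ -1 → i ≠ 0 → IsZero (P.X i))

lemma nonempty_splitting_stalkShortComplex (n : ℤ) :
    Nonempty ((stalkShortComplex P hP).map (eval C (.up ℤ) n)).Splitting := by
  rcases eq_or_ne n 0 with rfl | hn₀
  · have hf : IsIso ((stalkShortComplex P hP).f.f 0) := by
      rw [stalkShortComplex, mkHomFromSingle_f]
      infer_instance
    have h₃ : IsZero (((single C (.up ℤ) (-1)).obj (P.X (-1))).X 0) :=
      isZero_single_obj_X _ _ _ _ (by simp)
    exact ⟨.ofIsIsoOfIsZero _ hf h₃⟩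
  · have hg : IsIso ((stalkShortComplex P hP).g.f n) := by
      rcases eq_or_ne n (-1) with rfl | hn₁
      · rw [stalkShortComplex, mkHomToSingle_f]
        infer_instance
      · exact isIso_of_source_target_iso_zero _ (hP n hn₁ hn₀).isoZero
          (isZero_single_obj_X (.up ℤ) (-1) (P.X (-1)) n hn₁).isoZero
    have h₁ : IsZero (((single C (.up ℤ) 0).obj (P.X 0)).X n) := isZero_single_obj_X _ _ _ _ hn₀
    exact ⟨.ofIsZeroOfIsIso _ h₁ hg⟩

include hP in
lemma nonempty_twoTermPresentation_quotient [Projective (P.X (-1))] [Projective (P.X 0)] :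
    Nonempty (TwoTermPresentation (HomotopyCategory.homologyFunctor C (.up ℤ) 0)
      ((HomotopyCategory.quotient C (.up ℤ)).obj P)) := by
  let σ n := (nonempty_splitting_stalkShortComplex hP n).some
  have hT : CochainComplex.trianglehOfDegreewiseSplit _ σ ∈ distTriang _ :=
    (HomotopyCategory.distinguished_iff_iso_trianglehOfDegreewiseSplit _).2 ⟨_, σ, ⟨Iso.refl _⟩⟩
  exact
    ⟨{ Q₁ := ((HomotopyCategory.singleFunctor C (-1)).obj (P.X (-1)))⟦(-1 : ℤ)⟧
       Q₀ := (HomotopyCategory.singleFunctor C 0).obj (P.X 0)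
       d := _
       p := _
       δ := _
       distinguished := inv_rot_of_distTriang _ hT
       isProjectiveFor₁ := isProjectiveFor_single_shift _ _
       isProjectiveFor₀ := isProjectiveFor_single _ }⟩

end Complexes

section Modules

variable {A : Type u} [Ring A]

instance : (ModuleCat.isFG.{v} A).IsClosedUnderQuotients where
  prop_of_epi f _ hM := by
    rw [ModuleCat.isFG_iff] at hM ⊢
    exact Module.Finite.of_surjective f.hom ((ModuleCat.epi_iff_surjective f).1 inferInstance)

lemma isFG_of_mono [IsNoetherianRing A] {M N : ModuleCat.{v} A} (f : M ⟶ N) [Mono f]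
    (hN : ModuleCat.isFG A N) : ModuleCat.isFG A M := by
  rw [ModuleCat.isFG_iff] at hN ⊢
  exact Module.Finite.of_injective f.hom ((ModuleCat.mono_iff_injective f).1 inferInstance)

lemma exists_epi_of_isFG {M : ModuleCat.{u} A} (hM : ModuleCat.isFG A M) :
    ∃ (P : ModuleCat.{u} A) (f : P ⟶ M), (ModuleCat.isFG A P ∧ Projective P) ∧ Epi f := by
  rw [ModuleCat.isFG_iff] at hM
  obtain ⟨n, f, hf⟩ := Module.Finite.exists_fin' A M
  exact ⟨ModuleCat.of A (Fin n → A), ModuleCat.ofHom f,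
    ⟨(ModuleCat.isFG_iff _).2 (inferInstanceAs (Module.Finite A (Fin n → A))),
      (IsProjective.iff_projective (Fin n → A)).1 inferInstance⟩,
    (ModuleCat.epi_iff_surjective _).2 hf⟩

lemma exists_projective_presentation_of_isFG [IsNoetherianRing A] {M : ModuleCat.{u} A}
    (hM : ModuleCat.isFG A M) :
    ∃ (P₁ P₀ : ModuleCat.{u} A) (d : P₁ ⟶ P₀) (p : P₀ ⟶ M) (w : d ≫ p = 0),
      (ModuleCat.isFG A P₁ ∧ Projective P₁) ∧ (ModuleCat.isFG A P₀ ∧ Projective P₀) ∧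
        (ShortComplex.mk d p w).Exact ∧ Epi p := by
  obtain ⟨P₀, p, hP₀, hp⟩ := exists_epi_of_isFG hM
  obtain ⟨P₁, q, hP₁, hq⟩ := exists_epi_of_isFG (isFG_of_mono (kernel.ι p) hP₀.1)
  have hlift : kernel.lift p (q ≫ kernel.ι p) (by simp) = q := by simp [← cancel_mono (kernel.ι p)]
  refine ⟨P₁, P₀, q ≫ kernel.ι p, p, by simp, hP₁, hP₀, ?_, hp⟩
  rw [ShortComplex.exact_iff_epi_kernel_lift]
  rwa [hlift]

lemma twoTerm_quotient_twoTermComplex {P₁ P₀ : ModuleCat.{u} A} (d : P₁ ⟶ P₀)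
    (h₁ : ModuleCat.isFG A P₁ ∧ Projective P₁) (h₀ : ModuleCat.isFG A P₀ ∧ Projective P₀) :
    twoTerm A ((HomotopyCategory.quotient _ _).obj (twoTermComplex d)) := by
  refine ⟨twoTermComplex d, fun i => ?_, HomologicalComplex.isZero_double_X d _, ⟨Iso.refl _⟩⟩
  dsimp only [twoTermComplex, HomologicalComplex.double]
  split_ifs
  · exact h₁
  · exact h₀
  · exact ⟨(ModuleCat.isFG A).prop_of_epi (0 : P₀ ⟶ _) h₀.1, inferInstance⟩

variable (A) in
lemma H0_twoTerm [IsNoetherianRing A] : H0 (twoTerm A) = ModuleCat.isFG A := by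
  refine le_antisymm ?_ fun M hM => ?_
  · rintro M ⟨X, ⟨P, hP, hP', ⟨e⟩⟩, ⟨i⟩⟩
    obtain ⟨p, -, _, -⟩ := exists_exact_homologyFunctor_quotient
      ((hP' 1 (by simp) (by simp)).eq_of_tgt (P.d 0 1) 0)
    let j := (HomotopyCategory.homologyFunctor (ModuleCat.{u} A) (.up ℤ) 0).mapIso e.symm ≪≫ i
    exact (ModuleCat.isFG A).prop_of_epi (p ≫ j.hom) (hP 0).1
  · obtain ⟨P₁, P₀, d, p, w, h₁, h₀, hex, _⟩ := exists_projective_presentation_of_isFG hM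
    exact ⟨_, twoTerm_quotient_twoTermComplex d h₁ h₀,
      nonempty_homologyFunctor_twoTermComplex_iso hex⟩

lemma nonempty_twoTermPresentation {X : K A} (hX : twoTerm A X) :
    Nonempty (TwoTermPresentation
      (HomotopyCategory.homologyFunctor (ModuleCat.{u} A) (.up ℤ) 0) X) := by
  obtain ⟨P, hP, hP', ⟨e⟩⟩ := hX
  have := (hP (-1)).2
  have := (hP 0).2
  obtain ⟨R⟩ := nonempty_twoTermPresentation_quotient hP'
  exact ⟨R.ofIso e.symm⟩

end Modules

end TwoTermCotorsion

open TwoTermCotorsion in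
theorem mainTheorem6_general {A : Type u} [Ring A] [IsNoetherianRing A]
    {U V : ObjectProperty (K A)} (h : IsCompleteCotorsionPair (twoTerm A) U V) :
    IsLeftWeakCotorsionPair (H0 U) (H0 V) := by
  have hE (X : K A) (hX : twoTerm A X) := nonempty_twoTermPresentation hX
  have hFG : (twoTerm A).map (HomotopyCategory.homologyFunctor _ _ 0) = ModuleCat.isFG A :=
    H0_twoTerm A
  have : ((twoTerm A).map (HomotopyCategory.homologyFunctor _ _ 0)).IsClosedUnderQuotients :=
    hFG ▸ inferInstance
  exact
    { left_le := hFG ▸ ObjectProperty.map_monotone h.left_le _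
      right_le := hFG ▸ ObjectProperty.map_monotone h.right_le _
      left_iso := inferInstanceAs (U.map _).IsClosedUnderIsomorphisms
      right_iso := inferInstanceAs (V.map _).IsClosedUnderIsomorphisms
      ext_eq_zero := fun _ _ hM hN => h.ext_map_eq_zero hE hM hN
      exists_right := fun _ hM => h.exists_rightApproximation_map hE (hFG ▸ hM)
      exists_left := fun _ hM => h.exists_leftApproximation_map hE (hFG ▸ hM) }

theorem mainTheorem6 (k : Type w) [Field k] (A : Type u) [Ring A] [Algebra k A]
    [FiniteDimensional k A]
    (U V : CategoryTheory.ObjectProperty (TwoTermCotorsion.K A))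
    (h : TwoTermCotorsion.IsCompleteCotorsionPair (TwoTermCotorsion.twoTerm A) U V) :
    TwoTermCotorsion.IsLeftWeakCotorsionPair
      (TwoTermCotorsion.H0 U) (TwoTermCotorsion.H0 V) :=
  have : IsNoetherianRing A := isNoetherian_of_tower k inferInstance
  mainTheorem6_general h
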